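/- Let $d\ge 0$ and $N\ge 2$ be integers and let $\phi:(0,+\infty)\to[0,+\infty)$ be continuous and strictly decreasing with $\lim_{t\to0^+}\phi(t)=+\infty$; put $\phi(0)=+\infty$. For $\mathbf x=(x_1,\dots,x_N)\in(\mathbb R^d)^N$ and $\alpha>0$ let $$c(\mathbf x)=\sum_{1\le i<j\le N}\phi(|x_i-x_j|)\in[0,+\infty],\qquad c_\alpha(\mathbf x)=\sum_{1\le i<j\le N}\min\{\phi(|x_i-x_j|),\phi(\alpha)\}.$$ Let $\rho$ be a Borel probability measure on $\mathbb R^d$, let $\Pi(\rho)$ be the set of Borel probability measures on $(\mathbb R^d)^N$ all of whose $N$ marginals are $\rho$, and let $$C(\rho)=\min_{P\in\Pi(\rho)}\int c\,dP .$$ For a cost $k\in\{c,c_\alpha\}$, a Kantorovich potential for $k$ is a maximizer of $u\mapsto N\int u\,d\rho$ among the $\rho$-integrable functions $u:\mathbb R^d\to\mathbb R$ such that $u(x_1)+\dots+u(x_N)\le k(x_1,\dots,x_N)$ for all $x_1,\dots,x_N\in\mathbb R^d$. Let $\mu_\rho(r)=\sup_{x\in\mathbb R^d}\rho(B(x,r))$,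 where $B(x,r)$ is the open ball, and assume $$\textbf{(A)}\qquad \lim_{r\to0^+}\mu_\rho(r)<\frac1{N(N-1)^2}.$$ Then the minimum defining $C(\rho)$ is attained, and $$C(\rho)=\max\Big\{N\int u\,d\rho\ :\ u:\mathbb R^d\to\mathbb R\ \ \rho\text{-integrable},\ u(x_1)+\dots+u(x_N)\le c(x_1,\dots,x_N)\ \text{ for all }x_1,\dots,x_N\in\mathbb R^d\Big\},$$ where the maximum is attained (in particular $C(\rho)<+\infty$). Moreover, if $\beta>0$ satisfies $\mu_\rho(\beta)<\frac1{N(N-1)^2}$ and $0<\alpha\le\phi^{-1}\big(\frac{N^2(N-1)}2\phi(\beta)\big)$, then every Kantorovich potential for $c_\alpha$ is also a Kantorovich potential for $c$. -/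

import Mathlib

open MeasureTheory Filter Set
open scoped ENNReal Topology

noncomputable section

namespace RepulsiveOT

/-- `ℝ^d` with its Euclidean norm. -/
abbrev Space (d : ℕ) : Type := EuclideanSpace ℝ (Fin d)

/-- The standing assumptions on the radial profile `φ : (0,∞) → [0,∞)`: only the values on `(0,∞)`
are constrained, and only these are used below. -/
structure IsRepulsive (φ : ℝ → ℝ) : Prop where
  continuousOn : ContinuousOn φ (Ioi 0)
  nonneg : ∀ t, 0 < t → 0 ≤ φ t
  tendsto_zero : Tendsto φ (𝓝[>] 0) atTop
  strictAntiOn : StrictAntiOn φ (Ioi 0)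

/-- `φ` as a function on `[0,∞)` with values in `[0,∞]`, with `φ(0) = lim_{t → 0+} φ(t) = +∞`. -/
def extend (φ : ℝ → ℝ) (t : ℝ) : ℝ≥0∞ :=
  if 0 < t then ENNReal.ofReal (φ t) else ⊤

/-- The truncation `φ_α(t) = min {φ(t), φ(α)}`. -/
def truncate (φ : ℝ → ℝ) (α : ℝ) (t : ℝ) : ℝ≥0∞ :=
  min (extend φ t) (ENNReal.ofReal (φ α))

/-- `∑_{i < j} ψ(|x_i - x_j|)`. -/
def pairCost {d N : ℕ} (ψ : ℝ → ℝ≥0∞) (x : Fin N → Space d) : ℝ≥0∞ :=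
  ∑ i : Fin N, ∑ j ∈ Finset.Ioi i, ψ ‖x i - x j‖

/-- The repulsive cost `c`; it is `+∞` where two of the points coincide. -/
def cost {d N : ℕ} (φ : ℝ → ℝ) : (Fin N → Space d) → ℝ≥0∞ :=
  pairCost (extend φ)

/-- The truncated cost `c_α`. -/
def truncatedCost {d N : ℕ} (φ : ℝ → ℝ) (α : ℝ) : (Fin N → Space d) → ℝ≥0∞ :=
  pairCost (truncate φ α)

/-- The set `Π(ρ)` of transport plans: probabilities on `(ℝ^d)^N` all of whose `N` marginals
are `ρ`. -/
def plans {d : ℕ} (N : ℕ) (ρ : Measure (Space d)) : Set (Measure (Fin N → Space d)) :=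
  {P | IsProbabilityMeasure P ∧ ∀ i, P.map (fun x => x i) = ρ}

/-- The optimal transport cost for the cost function `k`: the infimum of `∫ k dP` over `Π(ρ)`. -/
def transportCost {d N : ℕ} (k : (Fin N → Space d) → ℝ≥0∞) (ρ : Measure (Space d)) : ℝ≥0∞ :=
  ⨅ P ∈ plans N ρ, ∫⁻ x, k x ∂P

/-- The competitors of the dual problem: the `ρ`-integrable functions `u` with
`u(x_1) + ⋯ + u(x_N) ≤ k(x_1, …, x_N)` everywhere. -/
def dualAdmissible {d N : ℕ} (k : (Fin N → Space d) → ℝ≥0∞) (ρ : Measure (Space d)) :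
    Set (Space d → ℝ) :=
  {u | Integrable u ρ ∧
    ∀ x : Fin N → Space d, ((∑ i, u (x i) : ℝ) : EReal) ≤ ((k x : ℝ≥0∞) : EReal)}

/-- The dual functional `N ∫ u dρ`. -/
def dualValue {d : ℕ} (N : ℕ) (ρ : Measure (Space d)) (u : Space d → ℝ) : ℝ :=
  (N : ℝ) * ∫ x, u x ∂ρ

/-- Kantorovich potentials for the cost function `k`: maximizers of the dual problem. -/
def IsKantorovichPotential {d N : ℕ} (k : (Fin N → Space d) → ℝ≥0∞) (ρ : Measure (Space d))
    (u : Space d → ℝ) : Prop :=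
  u ∈ dualAdmissible k ρ ∧ IsMaxOn (dualValue N ρ) (dualAdmissible k ρ) u

/-- The measure of concentration `μ_ρ(r) = sup_x ρ(B(x,r))`. -/
def concentration {d : ℕ} (ρ : Measure (Space d)) (r : ℝ) : ℝ≥0∞ :=
  ⨆ x : Space d, ρ (Metric.ball x r)

/-- The threshold `1 / (N (N-1)^2)`. -/
def threshold (N : ℕ) : ℝ≥0∞ :=
  ENNReal.ofReal (1 / ((N : ℝ) * ((N : ℝ) - 1) ^ 2))

/-- Assumption (A), small concentration with respect to `N`:
`lim_{r → 0+} μ_ρ(r) < 1 / (N (N-1)^2)`. -/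
def SmallConcentration {d : ℕ} (N : ℕ) (ρ : Measure (Space d)) : Prop :=
  ∃ l : ℝ≥0∞, Tendsto (concentration ρ) (𝓝[>] 0) (𝓝 l) ∧ l < threshold N

/-- The inverse of `φ : (0,∞) → φ((0,∞))`. -/
def inverse (φ : ℝ → ℝ) : ℝ → ℝ :=
  Function.invFunOn φ (Ioi 0)

end RepulsiveOT

end

open RepulsiveOT

/-! Truncating the profile makes the pair cost bounded and uniformly continuous. For such a cost the
linear-programming dual has no gap and both values are attained: a Hahn–Banach extension of the
value functional of the dual program is represented by a plan, and maximal subsolutions form a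
bounded equicontinuous family. At the optimum the potential is sharp on almost every tuple.

Small concentration keeps the points of these contact tuples apart. Given fewer than `N` tuples, a
union bound produces a contact tuple whose coordinates lie at distance at least `β` from all
coordinates of another index of the given tuples. So every contact tuple extends to `N` mutually
cross-separated ones. Shifting their coordinates cyclically leaves the sum of the potentials
unchanged, and each shifted tuple has all its points `β`-separated, so the total truncated cost of
the `N` tuples is at most `N² (N - 1) / 2 * φ β ≤ φ α`. Hence no contact tuple has two points closer
than `α`, and the truncated and the full cost agree almost everywhere for the plan. The plan and the
potential are then optimal for the full cost as well.
-/

noncomputable section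

open scoped BoundedContinuousFunction CompactlySupported

namespace RepulsiveOT

/-! ### Positive functionals on bounded continuous functions -/

section Riesz

variable {Y : Type*} [TopologicalSpace Y]

/-- The restriction to `C_c(Y, ℝ)` of a positive functional on bounded continuous functions, to
which the Riesz–Markov–Kakutani theorem applies. -/
def restrictCompactlySupported (L : (Y →ᵇ ℝ) →ₚ[ℝ] ℝ) : C_c(Y, ℝ) →ₚ[ℝ] ℝ :=
  PositiveLinearMap.mk₀
    { toFun := fun f => L f.toBoundedContinuousFunction
      map_add' := fun f g => by rw [← map_add]; rfl
      map_smul' := fun c f => by rw [RingHom.id_apply, ← map_smul]; rfl }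
    (fun _ hf => map_nonneg L hf)

theorem abs_map_mul_sub_le (L : (Y →ᵇ ℝ) →ₚ[ℝ] ℝ) (f : Y →ᵇ ℝ) {g : Y →ᵇ ℝ} (hg : g ≤ 1) :
    |L (f * g) - L f| ≤ ‖f‖ * L (1 - g) := by
  have hpt : ∀ y, |f y * g y - f y| ≤ ‖f‖ * (1 - g y) := fun y => by
    have h : 0 ≤ 1 - g y := sub_nonneg.2 (hg y)
    rw [← mul_sub_one, abs_mul, ← abs_neg (g y - 1), neg_sub, abs_of_nonneg h]
    exact mul_le_mul_of_nonneg_right (f.norm_coe_le_norm y) h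
  have hle : f * g - f ≤ ‖f‖ • (1 - g) := fun y => le_of_abs_le (hpt y)
  have hge : -(‖f‖ • (1 - g)) ≤ f * g - f := fun y => neg_le_of_abs_le (hpt y)
  rw [← map_sub, abs_le, ← smul_eq_mul, ← map_smul, ← map_neg]
  exact ⟨OrderHomClass.mono L hge, OrderHomClass.mono L hle⟩

theorem exists_compactlySupported_eqOn_one [R1Space Y] [LocallyCompactSpace Y] {K : Set Y}
    (hK : IsCompact K) : ∃ g : C_c(Y, ℝ), EqOn g 1 K ∧ ∀ y, g y ∈ Icc (0 : ℝ) 1 := by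
  obtain ⟨g, hgK, hg, -, hg01⟩ :=
    exists_continuousMap_one_of_isCompact_subset_isOpen hK isOpen_univ (subset_univ K)
  exact ⟨⟨g, hg⟩, hgK, hg01⟩

variable [MeasurableSpace Y]

/-- Integration of bounded continuous functions against a finite measure, as a positive linear
functional. -/
def integralFunctional [OpensMeasurableSpace Y] (P : Measure Y) [IsFiniteMeasure P] :
    (Y →ᵇ ℝ) →ₚ[ℝ] ℝ :=
  PositiveLinearMap.mk₀
    { toFun := fun f => ∫ y, f y ∂P
      map_add' := fun f g => integral_add (f.integrable P) (g.integrable P)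
      map_smul' := fun c _ => integral_const_mul c _ }
    (fun _ hf => integral_nonneg hf)

@[simp] theorem integralFunctional_apply [OpensMeasurableSpace Y] (P : Measure Y)
    [IsFiniteMeasure P] (f : Y →ᵇ ℝ) : integralFunctional P f = ∫ y, f y ∂P := rfl

variable [T2Space Y] [LocallyCompactSpace Y] [BorelSpace Y]

theorem rieszMeasure_univ_le (L : (Y →ᵇ ℝ) →ₚ[ℝ] ℝ) :
    RealRMK.rieszMeasure (restrictCompactlySupported L) univ ≤ ENNReal.ofReal (L 1) := by
  rw [isOpen_univ.measure_eq_iSup_isCompact]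
  refine iSup₂_le fun K _ => iSup_le fun hK => ?_
  obtain ⟨g, hgK, hg⟩ := exists_compactlySupported_eqOn_one hK
  refine (RealRMK.rieszMeasure_le_of_eq_one _ (fun y => (hg y).1) hK hgK).trans ?_
  exact ENNReal.ofReal_le_ofReal (OrderHomClass.mono L fun y => (hg y).2)

theorem exists_measure_forall_integral_eq (L : (Y →ᵇ ℝ) →ₚ[ℝ] ℝ)
    (htight : ∀ ε > 0, ∃ g : C_c(Y, ℝ),
      (∀ y, g y ≤ 1) ∧ L (1 - g.toBoundedContinuousFunction) ≤ ε) :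
    ∃ P : Measure Y, IsFiniteMeasure P ∧ ∀ f : Y →ᵇ ℝ, ∫ y, f y ∂P = L f := by
  set P := RealRMK.rieszMeasure (restrictCompactlySupported L)
  have hP : IsFiniteMeasure P := ⟨(rieszMeasure_univ_le L).trans_lt ENNReal.ofReal_lt_top⟩
  have hcompact : ∀ g : C_c(Y, ℝ), integralFunctional P g.toBoundedContinuousFunction =
      L g.toBoundedContinuousFunction := RealRMK.integral_rieszMeasure _
  have hone : integralFunctional P 1 ≤ L 1 := by
    have h := ENNReal.toReal_le_of_le_ofReal (map_nonneg L fun _ => zero_le_one)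
      (rieszMeasure_univ_le L)
    simpa [measureReal_def] using h
  have happrox : ∀ f : Y →ᵇ ℝ, ∀ ε > 0, dist (∫ y, f y ∂P) (L f) ≤ ε * (2 * ‖f‖) := by
    intro f ε hε
    obtain ⟨g, hg, hLg⟩ := htight ε hε
    set G : Y →ᵇ ℝ := g.toBoundedContinuousFunction
    have hPg : integralFunctional P (1 - G) ≤ ε := by
      refine le_trans ?_ hLg
      rw [map_sub, map_sub, hcompact]
      exact sub_le_sub_right hone _
    have hP := abs_map_mul_sub_le (integralFunctional P) f (g := G) hg
    have hfG : integralFunctional P (f * G) = L (f * G) := hcompact (f.toContinuousMap • g)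
    have hL := abs_map_mul_sub_le L f (g := G) hg
    rw [hfG] at hP
    calc dist (∫ y, f y ∂P) (L f)
        ≤ |L (f * G) - ∫ y, f y ∂P| + |L (f * G) - L f| := dist_triangle_left _ _ _
      _ ≤ ‖f‖ * ε + ‖f‖ * ε :=
        add_le_add (hP.trans (by gcongr)) (hL.trans (by gcongr))
      _ = ε * (2 * ‖f‖) := by ring
  refine ⟨P, hP, fun f => dist_le_zero.1 ?_⟩
  rw [← zero_mul (2 * ‖f‖)]
  exact le_mul_of_forall_lt₀ fun ε hε b hb =>
    (happrox f ε hε).trans (mul_le_mul_of_nonneg_left hb.le hε.le)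

end Riesz

/-! ### Couplings as positive functionals -/

theorem exists_compactlySupported_integral_one_sub_le {Y : Type*} [TopologicalSpace Y] [R1Space Y]
    [LocallyCompactSpace Y] [MeasurableSpace Y] [OpensMeasurableSpace Y] {μ : Measure Y}
    [IsFiniteMeasure μ] (hμ : IsTightMeasureSet {μ}) {ε : ℝ} (hε : 0 < ε) :
    ∃ g : C_c(Y, ℝ), (∀ y, g y ∈ Icc (0 : ℝ) 1) ∧ ∫ y, (1 - g y) ∂μ ≤ ε := by
  obtain ⟨K, hK, hμK⟩ := isTightMeasureSet_iff_exists_isCompact_measure_compl_le.1 hμ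
    (ENNReal.ofReal ε) (ENNReal.ofReal_pos.2 hε)
  obtain ⟨g, hgK, hg⟩ := exists_compactlySupported_eqOn_one hK
  refine ⟨g, hg, ?_⟩
  have hgKc : ∫ y, (1 - g y) ∂μ = ∫ y in Kᶜ, (1 - g y) ∂μ :=
    (setIntegral_eq_integral_of_forall_compl_eq_zero fun y hy => by
      rw [hgK (not_notMem.1 hy), Pi.one_apply, sub_self]).symm
  rw [hgKc]
  refine (Real.le_norm_self _).trans <| (norm_setIntegral_le_of_norm_le_const
    (measure_lt_top μ _) (C := 1) fun y _ => ?_).trans ?_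
  · rw [Real.norm_of_nonneg (sub_nonneg.2 (hg y).2)]
    exact sub_le_self 1 (hg y).1
  · rw [one_mul]
    exact ENNReal.toReal_le_of_le_ofReal hε.le (hμK μ rfl)

theorem one_sub_prod_le_sum_one_sub {ι : Type*} (s : Finset ι) {a : ι → ℝ}
    (ha : ∀ i ∈ s, a i ∈ Icc (0 : ℝ) 1) : 1 - ∏ i ∈ s, a i ≤ ∑ i ∈ s, (1 - a i) := by
  classical
  induction s using Finset.induction_on with
  | empty => simp
  | insert i s hi ih =>
    rw [Finset.prod_insert hi, Finset.sum_insert hi]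
    rw [Finset.forall_mem_insert] at ha
    have hs : 0 ≤ 1 - ∏ j ∈ s, a j :=
      sub_nonneg.2 (Finset.prod_le_one (fun j hj => (ha.2 j hj).1) fun j hj => (ha.2 j hj).2)
    linarith [mul_le_of_le_one_left hs ha.1.2, ih ha.2]

section Couplings

variable {ι : Type*} {X : ι → Type*}

/-- The couplings of a family of measures: the probability measures on the product with marginals
`μ i`. -/
def couplings [∀ i, MeasurableSpace (X i)] (μ : ∀ i, Measure (X i)) : Set (Measure (∀ i, X i)) :=
  {P | IsProbabilityMeasure P ∧ ∀ i, P.map (fun x => x i) = μ i}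

variable [∀ i, TopologicalSpace (X i)]

/-- The pullback `x ↦ u (x i)` of bounded continuous functions from a factor to the product. -/
def coordPullback (i : ι) : (X i →ᵇ ℝ) →ₗ[ℝ] (∀ j, X j) →ᵇ ℝ where
  toFun u := u.compContinuous ⟨fun x => x i, continuous_apply i⟩
  map_add' _ _ := rfl
  map_smul' _ _ := rfl

@[simp] theorem coordPullback_apply (i : ι) (u : X i →ᵇ ℝ) (x : ∀ j, X j) :
    coordPullback i u x = u (x i) := rfl

/-- The tensor product `x ↦ ∏ i, g i (x i)` of compactly supported functions. -/
def tensorProd [Fintype ι] [∀ i, T2Space (X i)] (g : ∀ i, C_c(X i, ℝ)) : C_c(∀ i, X i, ℝ) where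
  toFun x := ∏ i, g i (x i)
  continuous_toFun := by fun_prop
  hasCompactSupport' := by
    refine HasCompactSupport.intro (isCompact_univ_pi fun i => (g i).hasCompactSupport)
      fun x hx => ?_
    obtain ⟨i, hi⟩ : ∃ i, x i ∉ tsupport (g i) := by simpa using hx
    exact Finset.prod_eq_zero (Finset.mem_univ i) (image_eq_zero_of_notMem_tsupport hi)

@[simp] theorem tensorProd_apply [Fintype ι] [∀ i, T2Space (X i)] (g : ∀ i, C_c(X i, ℝ))
    (x : ∀ i, X i) : tensorProd g x = ∏ i, g i (x i) := rfl

variable [Finite ι] [∀ i, T2Space (X i)] [∀ i, LocallyCompactSpace (X i)]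
  [∀ i, SecondCountableTopology (X i)] [∀ i, MeasurableSpace (X i)] [∀ i, BorelSpace (X i)]
  {μ : ∀ i, Measure (X i)} [∀ i, IsProbabilityMeasure (μ i)]

theorem exists_tensorProd_map_one_sub_le (L : ((∀ i, X i) →ᵇ ℝ) →ₚ[ℝ] ℝ)
    (hL : ∀ i u, L (coordPullback i u) = ∫ x, u x ∂μ i) {ε : ℝ} (hε : 0 < ε) :
    ∃ G : C_c(∀ i, X i, ℝ), (∀ x, G x ≤ 1) ∧ L (1 - G.toBoundedContinuousFunction) ≤ ε := by
  have := Fintype.ofFinite ι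
  have hδ : 0 < ε / (Fintype.card ι + 1) := by positivity
  choose g hg hgμ using fun i => exists_compactlySupported_integral_one_sub_le
    (isTightMeasureSet_singleton_of_innerRegular (μ := μ i)) hδ
  refine ⟨tensorProd g, fun x =>
    Finset.prod_le_one (fun i _ => (hg i (x i)).1) fun i _ => (hg i (x i)).2, ?_⟩
  calc L (1 - (tensorProd g).toBoundedContinuousFunction)
      ≤ L (∑ i, coordPullback i (1 - (g i).toBoundedContinuousFunction)) :=
        OrderHomClass.mono L fun x => by
          simpa using one_sub_prod_le_sum_one_sub Finset.univ fun i _ => hg i (x i)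
    _ = ∑ i, ∫ x, (1 - g i x) ∂μ i := by
        simp only [map_sum, hL]
        rfl
    _ ≤ ∑ _i : ι, ε / (Fintype.card ι + 1) := Finset.sum_le_sum fun i _ => hgμ i
    _ ≤ ε := by
        rw [Finset.sum_const, Finset.card_univ, nsmul_eq_mul, mul_div_left_comm]
        exact mul_le_of_le_one_right hε.le (div_le_one_of_le₀ (by linarith) (by positivity))

theorem exists_mem_couplings_forall_integral_eq [Nonempty ι] (L : ((∀ i, X i) →ᵇ ℝ) →ₚ[ℝ] ℝ)
    (hL : ∀ i u, L (coordPullback i u) = ∫ x, u x ∂μ i) :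
    ∃ P ∈ couplings μ, ∀ f : (∀ i, X i) →ᵇ ℝ, ∫ x, f x ∂P = L f := by
  obtain ⟨P, hPfin, hP⟩ := exists_measure_forall_integral_eq L fun ε hε =>
    exists_tensorProd_map_one_sub_le L hL hε
  have hmarg : ∀ i, P.map (fun x => x i) = μ i := fun i => by
    refine ext_of_forall_integral_eq_of_IsFiniteMeasure fun u => ?_
    rw [integral_map (measurable_pi_apply i).aemeasurable u.continuous.aestronglyMeasurable, ← hL,
      ← hP]
    rfl
  obtain ⟨i⟩ := ‹Nonempty ι›
  have : IsProbabilityMeasure (P.map fun x => x i) := by rw [hmarg i]; infer_instance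
  exact ⟨P, ⟨Measure.isProbabilityMeasure_of_map (fun x => x i), hmarg⟩, hP⟩

end Couplings

/-! ### Duality for bounded continuous costs -/

section LinearProgram

theorem exists_linearMap_eq_and_le_of_sublinear {E : Type*} [AddCommGroup E] [Module ℝ E]
    {p : E → ℝ} (hsmul : ∀ c : ℝ, 0 < c → ∀ x, p (c • x) = c * p x)
    (hadd : ∀ x y, p (x + y) ≤ p x + p y) (x : E) :
    ∃ L : E →ₗ[ℝ] ℝ, L x = p x ∧ ∀ y, L y ≤ p y := by
  have hzero : p 0 = 0 := by
    have h := hsmul 2 two_pos 0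
    rw [smul_zero] at h
    linarith
  have hneg : ∀ y, -p (-y) ≤ p y := fun y => by
    have h := hadd y (-y)
    rw [add_neg_cancel, hzero] at h
    linarith
  have hspan : ∀ c : ℝ, c • x = 0 → c • p x = 0 := fun c hc => by
    rcases smul_eq_zero.1 hc with rfl | rfl
    · rw [zero_smul]
    · rw [hzero, smul_zero]
  have hle : ∀ c : ℝ, c * p x ≤ p (c • x) := fun c => by
    rcases lt_trichotomy c 0 with hc | rfl | hc
    · have h := hneg (c • x)
      rw [← neg_smul, hsmul _ (neg_pos.2 hc)] at h
      linarith
    · rw [zero_mul, zero_smul, hzero]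
    · exact (hsmul c hc x).ge
  obtain ⟨L, hLx, hL⟩ := exists_extension_of_le_sublinear
    (LinearPMap.mkSpanSingleton' x (p x) hspan) p hsmul hadd fun ⟨y, hy⟩ => by
      obtain ⟨c, rfl⟩ := Submodule.mem_span_singleton.1 hy
      rw [LinearPMap.mkSpanSingleton'_apply]
      exact hle c
  exact ⟨L, (hLx ⟨x, Submodule.mem_span_singleton_self x⟩).trans
    (LinearPMap.mkSpanSingleton'_apply_self _ _ hspan _), hL⟩

variable {U F : Type*} [AddCommGroup U] [Module ℝ U] [AddCommGroup F] [PartialOrder F]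
  [Module ℝ F] {S : U →ₗ[ℝ] F} {J : U →ₗ[ℝ] ℝ}

/-- The value `inf {J u | f ≤ S u}` of the linear program with objective `J` and constraint map
`S`. It is the infimum of a set of reals, so it means something only for feasible bounded
programs. -/
def programValue (S : U →ₗ[ℝ] F) (J : U →ₗ[ℝ] ℝ) (f : F) : ℝ := sInf (J '' {u | f ≤ S u})

theorem le_programValue (hS : ∀ f, ∃ u, f ≤ S u) {f : F} {a : ℝ}
    (ha : ∀ u, f ≤ S u → a ≤ J u) : a ≤ programValue S J f :=
  le_csInf (Set.Nonempty.image J (hS f)) (forall_mem_image.2 ha)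

variable [IsOrderedAddMonoid F]

theorem programValue_le (hS : ∀ f, ∃ u, f ≤ S u) (hJ : ∀ u, 0 ≤ S u → 0 ≤ J u) {f : F} {u : U}
    (hu : f ≤ S u) : programValue S J f ≤ J u := by
  obtain ⟨v, hv⟩ := hS (-f)
  refine csInf_le ⟨-J v, ?_⟩ ⟨u, hu, rfl⟩
  rintro _ ⟨w, hw, rfl⟩
  have h := hJ (w + v) (by rw [map_add, ← add_neg_cancel f]; exact add_le_add hw hv)
  rw [map_add] at h
  linarith

theorem programValue_add_le (hS : ∀ f, ∃ u, f ≤ S u) (hJ : ∀ u, 0 ≤ S u → 0 ≤ J u) (f g : F) :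
    programValue S J (f + g) ≤ programValue S J f + programValue S J g := by
  rw [← sub_le_iff_le_add]
  refine le_programValue hS fun u hu => ?_
  rw [sub_le_comm]
  refine le_programValue hS fun v hv => ?_
  rw [sub_le_iff_le_add', ← map_add]
  exact programValue_le hS hJ (by rw [map_add]; exact add_le_add hu hv)

theorem programValue_smul_le [PosSMulMono ℝ F] (hS : ∀ f, ∃ u, f ≤ S u)
    (hJ : ∀ u, 0 ≤ S u → 0 ≤ J u) {c : ℝ} (hc : 0 < c) (f : F) :
    programValue S J (c • f) ≤ c * programValue S J f := by
  rw [← div_le_iff₀' hc]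
  refine le_programValue hS fun u hu => ?_
  rw [div_le_iff₀' hc, ← smul_eq_mul, ← map_smul]
  exact programValue_le hS hJ (by rw [map_smul]; exact smul_le_smul_of_nonneg_left hu hc.le)

theorem programValue_smul [PosSMulMono ℝ F] (hS : ∀ f, ∃ u, f ≤ S u)
    (hJ : ∀ u, 0 ≤ S u → 0 ≤ J u) {c : ℝ} (hc : 0 < c) (f : F) :
    programValue S J (c • f) = c * programValue S J f := by
  refine le_antisymm (programValue_smul_le hS hJ hc f) ?_
  have h := programValue_smul_le hS hJ (inv_pos.2 hc) (c • f)
  rwa [inv_smul_smul₀ hc.ne', le_inv_mul_iff₀ hc] at h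

theorem exists_positive_extension_isLUB [PosSMulMono ℝ F] (hS : ∀ f, ∃ u, f ≤ S u)
    (hJ : ∀ u, 0 ≤ S u → 0 ≤ J u) (k : F) :
    ∃ L : F →ₚ[ℝ] ℝ, (∀ u, L (S u) = J u) ∧ IsLUB (J '' {u | S u ≤ k}) (L k) := by
  obtain ⟨L, hLk, hL⟩ := exists_linearMap_eq_and_le_of_sublinear
    (fun c hc f => programValue_smul hS hJ hc f) (programValue_add_le hS hJ) (-k)
  have hLJ : ∀ f u, f ≤ S u → L f ≤ J u := fun f u hu => (hL f).trans (programValue_le hS hJ hu)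
  have hpos : ∀ f, 0 ≤ f → 0 ≤ L f := fun f hf => by
    simpa using hLJ (-f) 0 (by simpa using hf)
  have hext : ∀ u, L (S u) = J u := fun u =>
    le_antisymm (hLJ _ u le_rfl) (by simpa using hLJ (S (-u)) (-u) le_rfl)
  refine ⟨PositiveLinearMap.mk₀ L hpos, hext, ?_, fun a ha => ?_⟩
  · rintro _ ⟨u, hu, rfl⟩
    rw [← hext u]
    exact OrderHomClass.mono (PositiveLinearMap.mk₀ L hpos) hu
  · have h : -a ≤ L (-k) := by
      rw [hLk]
      refine le_programValue hS fun u hu => ?_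
      have := ha ⟨-u, by simpa [neg_le] using hu, rfl⟩
      rw [map_neg] at this
      linarith
    rw [map_neg] at h
    exact neg_le_neg_iff.1 h

end LinearProgram

section Duality

variable {ι : Type*} [Fintype ι] {X : ι → Type*} [∀ i, TopologicalSpace (X i)]

/-- The constraint map `u ↦ (x ↦ ∑ i, u i (x i))` of the dual transport problem. -/
def separableSum : (∀ i, X i →ᵇ ℝ) →ₗ[ℝ] (∀ i, X i) →ᵇ ℝ :=
  ∑ i, coordPullback i ∘ₗ LinearMap.proj i

@[simp] theorem separableSum_apply (u : ∀ i, X i →ᵇ ℝ) (x : ∀ i, X i) :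
    separableSum u x = ∑ i, u i (x i) := by
  simp [separableSum]

theorem separableSum_single [DecidableEq ι] (i : ι) (u : X i →ᵇ ℝ) :
    separableSum (Pi.single i u) = coordPullback i u := by
  ext x
  rw [separableSum_apply, Fintype.sum_eq_single i fun j hj => by simp [hj]]
  simp

theorem exists_le_separableSum [Nonempty ι] (f : (∀ i, X i) →ᵇ ℝ) :
    ∃ u : ∀ i, X i →ᵇ ℝ, f ≤ separableSum u := by
  refine ⟨fun _ => BoundedContinuousFunction.const _ ‖f‖, fun x => ?_⟩
  obtain ⟨i⟩ := ‹Nonempty ι›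
  change f x ≤ separableSum _ x
  rw [separableSum_apply]
  exact (f.apply_le_norm x).trans (Finset.single_le_sum (f := fun _ : ι => ‖f‖)
    (fun _ _ => norm_nonneg f) (Finset.mem_univ i))

variable [∀ i, MeasurableSpace (X i)]

/-- The objective `u ↦ ∑ i, ∫ u i dμ i` of the dual transport problem. -/
def integralSum [∀ i, OpensMeasurableSpace (X i)] (μ : ∀ i, Measure (X i))
    [∀ i, IsFiniteMeasure (μ i)] : (∀ i, X i →ᵇ ℝ) →ₗ[ℝ] ℝ :=
  ∑ i, (integralFunctional (μ i)).toLinearMap ∘ₗ LinearMap.proj i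

@[simp] theorem integralSum_apply [∀ i, OpensMeasurableSpace (X i)] (μ : ∀ i, Measure (X i))
    [∀ i, IsFiniteMeasure (μ i)] (u : ∀ i, X i →ᵇ ℝ) :
    integralSum μ u = ∑ i, ∫ x, u i x ∂μ i := by
  simp [integralSum]

theorem integralSum_single [DecidableEq ι] [∀ i, OpensMeasurableSpace (X i)]
    (μ : ∀ i, Measure (X i)) [∀ i, IsFiniteMeasure (μ i)] (i : ι) (u : X i →ᵇ ℝ) :
    integralSum μ (Pi.single i u) = ∫ x, u x ∂μ i := by
  rw [integralSum_apply, Fintype.sum_eq_single i fun j hj => by simp [hj]]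
  simp

theorem integralSum_nonneg [∀ i, OpensMeasurableSpace (X i)] (μ : ∀ i, Measure (X i))
    [∀ i, IsProbabilityMeasure (μ i)] {u : ∀ i, X i →ᵇ ℝ} (hu : 0 ≤ separableSum u) :
    0 ≤ integralSum μ u := by
  choose x hx using fun i => exists_le_integral ((u i).integrable (μ i))
  have hux : 0 ≤ ∑ i, u i (x i) := by simpa using hu x
  rw [integralSum_apply]
  exact hux.trans (Finset.sum_le_sum fun i _ => hx i)

theorem exists_mem_couplings_isLUB [Nonempty ι] [∀ i, T2Space (X i)]
    [∀ i, LocallyCompactSpace (X i)] [∀ i, SecondCountableTopology (X i)] [∀ i, BorelSpace (X i)]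
    (μ : ∀ i, Measure (X i)) [∀ i, IsProbabilityMeasure (μ i)] (k : (∀ i, X i) →ᵇ ℝ) :
    ∃ P ∈ couplings μ, IsLUB (integralSum μ '' {u | separableSum u ≤ k}) (∫ x, k x ∂P) := by
  classical
  have : PosSMulMono ℝ ((∀ i, X i) →ᵇ ℝ) :=
    ⟨fun c hc f g hfg x => mul_le_mul_of_nonneg_left (hfg x) hc⟩
  obtain ⟨L, hL, hLk⟩ :=
    exists_positive_extension_isLUB exists_le_separableSum (fun _ => integralSum_nonneg μ) k
  obtain ⟨P, hP, hPL⟩ := exists_mem_couplings_forall_integral_eq (μ := μ) L fun i u => by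
    rw [← separableSum_single, hL, integralSum_single]
  exact ⟨P, hP, by rwa [hPL]⟩

end Duality

/-! ### Symmetric costs -/

theorem exists_subseq_tendsto_of_equicontinuous {X E : Type*} [TopologicalSpace X]
    [TopologicalSpace.SeparableSpace X] [UniformSpace E] [FirstCountableTopology E]
    {v : ℕ → X → E} (hv : Equicontinuous v) {K : X → Set E} (hK : ∀ x, IsCompact (K x))
    (hvK : ∀ n x, v n x ∈ K x) :
    ∃ u : X → E, Continuous u ∧ (∀ x, u x ∈ K x) ∧
      ∃ s : ℕ → ℕ, StrictMono s ∧ ∀ x, Tendsto (fun n => v (s n) x) atTop (𝓝 (u x)) := by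
  rcases isEmpty_or_nonempty X with hX | hX
  · exact ⟨v 0, continuous_of_discreteTopology, hvK 0, id, strictMono_id, fun x => isEmptyElim x⟩
  obtain ⟨u, huK, hu⟩ := (isCompact_univ_pi hK).exists_mapClusterPt (u := v) (f := atTop)
    (tendsto_principal.2 (Eventually.of_forall fun n x _ => hvK n x))
  have hcont : Continuous u :=
    (equicontinuous_iff_range.1 hv).closure.continuous
      ⟨u, (isClosed_closure (s := range v)).mem_of_mapClusterPt hu
        (Eventually.of_forall fun n => subset_closure (mem_range_self n))⟩
  obtain ⟨s, hs, hsu⟩ := MapClusterPt.tendsto_subseq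
    (hu.continuousAt_comp (f := fun w m => w (TopologicalSpace.denseSeq X m))
      (continuous_pi fun m => continuous_apply _).continuousAt)
  have hclosed : IsClosed {x | Tendsto (fun n => v (s n) x) atTop (𝓝 (u x))} :=
    Equicontinuous.isClosed_setOfPred_tendsto (hv.comp s) hcont
  refine ⟨u, hcont, fun x => huK x (mem_univ x), s, hs, fun x => ?_⟩
  exact (TopologicalSpace.denseRange_denseSeq X).induction_on x hclosed (tendsto_pi_nhds.1 hsu)

section Subsolutions

variable {ι X : Type*} [Fintype ι]

/-- The subsolutions of a symmetric cost `k`: the functions `u` on one factor with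
`∑ i, u (x i) ≤ k x` everywhere. -/
def subsolutions (k : (ι → X) → ℝ) : Set (X → ℝ) := {u | ∀ x : ι → X, ∑ i, u (x i) ≤ k x}

theorem le_div_card_of_mem_subsolutions [Nonempty ι] {k : (ι → X) → ℝ} {u : X → ℝ}
    (hu : u ∈ subsolutions k) (x : X) : u x ≤ k (fun _ => x) / Fintype.card ι := by
  rw [le_div_iff₀' (by exact_mod_cast Fintype.card_pos)]
  simpa using hu fun _ => x

theorem exists_maximal_subsolution_ge [Nonempty ι] {k : (ι → X) → ℝ} {v : X → ℝ}
    (hv : v ∈ subsolutions k) : ∃ u, v ≤ u ∧ Maximal (· ∈ subsolutions k) u := by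
  refine zorn_le_nonempty₀ (subsolutions k) (fun c hc hchain y hy => ?_) v hv
  have hbdd : ∀ x, BddAbove (range fun w : c => (w : X → ℝ) x) := fun x =>
    ⟨_, forall_mem_range.2 fun w => le_div_card_of_mem_subsolutions (hc w.2) x⟩
  have : Nonempty c := ⟨⟨y, hy⟩⟩
  have : IsDirectedOrder c := ⟨hchain.directedOn.directed_val⟩
  refine ⟨fun x => ⨆ w : c, (w : X → ℝ) x, fun x => ?_, fun w hw x => le_ciSup (hbdd x) ⟨w, hw⟩⟩
  exact le_of_tendsto' (tendsto_finsetSum _ fun i _ =>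
    tendsto_atTop_ciSup (fun a b (h : (a : X → ℝ) ≤ b) => h (x i)) (hbdd (x i)))
    fun w : c => hc w.2 x

theorem exists_almost_contact [Nonempty ι] {k : (ι → X) → ℝ} {u : X → ℝ}
    (hu : Maximal (· ∈ subsolutions k) u) (x : X) {ε : ℝ} (hε : 0 < ε) :
    ∃ (z : ι → X) (i : ι), z i = x ∧ k z - ε < ∑ j, u (z j) := by
  classical
  by_contra! h
  obtain ⟨b, hbx, hb, hb_zero⟩ : ∃ b : X → ℝ, b x = ε / Fintype.card ι ∧
      (∀ y, b y ∈ Icc 0 (ε / Fintype.card ι)) ∧ ∀ y, y ≠ x → b y = 0 := by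
    have hδ : 0 ≤ ε / Fintype.card ι := by positivity
    refine ⟨Pi.single x (ε / Fintype.card ι), Pi.single_eq_same _ _, fun y => ?_,
      fun y hy => Pi.single_eq_of_ne hy _⟩
    rw [Pi.single_apply]
    split_ifs
    exacts [⟨hδ, le_rfl⟩, ⟨le_rfl, hδ⟩]
  have hsum : ∀ z : ι → X, ∑ j, b (z j) ≤ ε := fun z =>
    (Finset.sum_le_sum fun j _ => (hb (z j)).2).trans_eq <| by
      rw [Finset.sum_const, Finset.card_univ, nsmul_eq_mul,
        mul_div_cancel₀ _ (Nat.cast_ne_zero.2 Fintype.card_ne_zero)]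
  have hmem : u + b ∈ subsolutions k := fun z => by
    simp only [Pi.add_apply, Finset.sum_add_distrib]
    by_cases hz : ∃ i, z i = x
    · obtain ⟨i, hi⟩ := hz
      linarith [h z i hi, hsum z]
    · push Not at hz
      simpa only [hb_zero _ (hz _), Finset.sum_const_zero, add_zero] using hu.prop z
  have hx : u x + b x ≤ u x := hu.le_of_ge hmem (le_add_of_nonneg_right fun y => (hb y).1) x
  have hpos : 0 < ε / Fintype.card ι := by positivity
  linarith

theorem exists_sub_lt_update_sub_add [Nonempty ι] [DecidableEq ι] {k : (ι → X) → ℝ} {u : X → ℝ}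
    (hu : Maximal (· ∈ subsolutions k) u) (x y : X) {ε : ℝ} (hε : 0 < ε) :
    ∃ (z : ι → X) (i : ι), z i = x ∧ u y - u x < k (Function.update z i y) - k z + ε := by
  obtain ⟨z, i, rfl, hz⟩ := exists_almost_contact hu x hε
  refine ⟨z, i, rfl, ?_⟩
  have hle := hu.prop (Function.update z i y)
  have hsum : ∑ j, u (Function.update z i y j) - ∑ j, u (z j) = u y - u (z i) := by
    rw [← Finset.sum_sub_distrib, Fintype.sum_eq_single i fun j hj => by simp [hj]]
    simp
  linarith

theorem abs_le_of_maximal_subsolution [Nonempty ι] {k : (ι → X) → ℝ} {u : X → ℝ}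
    (hu : Maximal (· ∈ subsolutions k) u) {M : ℝ} (hk : ∀ x, |k x| ≤ M) (x : X) :
    |u x| ≤ 2 * M := by
  have hcard : (1 : ℝ) ≤ Fintype.card ι := by exact_mod_cast Fintype.card_pos
  have hM : 0 ≤ M := (abs_nonneg _).trans (hk fun _ => x)
  have hle : ∀ y, u y ≤ M / Fintype.card ι := fun y =>
    (le_div_card_of_mem_subsolutions hu.prop y).trans (by gcongr; exact le_of_abs_le (hk _))
  have hdiv : M / Fintype.card ι ∈ Icc 0 M := ⟨by positivity, div_le_self hM hcard⟩
  refine abs_le.2 ⟨le_of_forall_pos_le_add fun ε hε => ?_, by linarith [hle x, hdiv.2]⟩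
  obtain ⟨z, i, rfl, hz⟩ := exists_almost_contact hu x hε
  have hdefect : M / Fintype.card ι - u (z i) ≤ ∑ j, (M / Fintype.card ι - u (z j)) :=
    Finset.single_le_sum (f := fun j => M / Fintype.card ι - u (z j))
      (fun j _ => sub_nonneg.2 (hle (z j))) (Finset.mem_univ i)
  rw [Finset.sum_sub_distrib, Finset.sum_const, Finset.card_univ, nsmul_eq_mul,
    mul_div_cancel₀ _ (by positivity)] at hdefect
  linarith [neg_le_of_abs_le (hk z), hdiv.1]

theorem uniformEquicontinuous_maximal_subsolutions [Nonempty ι] [PseudoMetricSpace X]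
    {k : (ι → X) → ℝ} (hk : UniformContinuous k) :
    UniformEquicontinuous ((↑) : {u // Maximal (· ∈ subsolutions k) u} → X → ℝ) := by
  classical
  rw [Metric.uniformEquicontinuous_iff]
  intro ε hε
  obtain ⟨δ, hδ, hkδ⟩ := Metric.uniformContinuous_iff.1 hk (ε / 2) (half_pos hε)
  have hosc : ∀ u : {u // Maximal (· ∈ subsolutions k) u}, ∀ x y, dist x y < δ →
      u.1 y - u.1 x < ε := fun u x y hxy => by
    obtain ⟨z, i, rfl, hz⟩ := exists_sub_lt_update_sub_add u.2 x y (half_pos hε)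
    have hdist : dist (Function.update z i y) z < δ := (dist_pi_lt_iff hδ).2 fun j => by
      rcases eq_or_ne j i with rfl | hj
      · rwa [Function.update_self, dist_comm]
      · rwa [Function.update_of_ne hj, dist_self]
    linarith [lt_of_abs_lt (hkδ hdist)]
  refine ⟨δ, hδ, fun x y hxy u => ?_⟩
  rw [Real.dist_eq, abs_sub_lt_iff]
  exact ⟨hosc u y x (by rwa [dist_comm]), hosc u x y hxy⟩

end Subsolutions

theorem average_mem_subsolutions {X : Type*} {N : ℕ} [NeZero N] {k : (Fin N → X) → ℝ}
    (hsymm : ∀ (σ : Equiv.Perm (Fin N)) x, k (x ∘ σ) = k x) {u : Fin N → X → ℝ}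
    (hu : ∀ x : Fin N → X, ∑ i, u i (x i) ≤ k x) :
    (fun y => (N : ℝ)⁻¹ * ∑ j, u j y) ∈ subsolutions k := by
  intro x
  rw [← Finset.mul_sum, inv_mul_le_iff₀ (by exact_mod_cast Nat.pos_of_neZero N)]
  calc ∑ i, ∑ j, u j (x i) = ∑ j, ∑ i, u j (x i) := Finset.sum_comm
    _ = ∑ j, ∑ m, u j (x (j + m)) := Finset.sum_congr rfl fun j _ =>
        (Equiv.sum_comp (Equiv.addLeft j) fun i => u j (x i)).symm
    _ = ∑ m, ∑ j, u j (x (j + m)) := Finset.sum_comm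
    _ ≤ ∑ _m : Fin N, k x := Finset.sum_le_sum fun m _ => by
        rw [← hsymm (Equiv.addRight m) x]
        exact hu (x ∘ Equiv.addRight m)
    _ = N * k x := by simp

section SymmetricDuality

variable {X : Type*} [PseudoMetricSpace X] [MeasurableSpace X] (ρ : Measure X)

theorem integrable_of_maximal_subsolution {ι : Type*} [Fintype ι] [Nonempty ι]
    [OpensMeasurableSpace X] [IsFiniteMeasure ρ] {k : (ι → X) →ᵇ ℝ}
    (hk : UniformContinuous k) {u : X → ℝ} (hu : Maximal (· ∈ subsolutions k) u) :
    Integrable u ρ :=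
  Integrable.of_bound
    ((uniformEquicontinuous_maximal_subsolutions hk).equicontinuous.continuous
      ⟨u, hu⟩).measurable.aestronglyMeasurable (2 * ‖k‖)
    (Eventually.of_forall (abs_le_of_maximal_subsolution hu k.norm_coe_le_norm))

theorem exists_maximal_subsolution_integral_ge {N : ℕ} [NeZero N] [OpensMeasurableSpace X]
    [IsFiniteMeasure ρ] {k : (Fin N → X) →ᵇ ℝ} (hk : UniformContinuous k)
    (hsymm : ∀ (σ : Equiv.Perm (Fin N)) x, k (x ∘ σ) = k x) {u : Fin N → X →ᵇ ℝ}
    (hu : separableSum u ≤ k) :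
    ∃ w, Maximal (· ∈ subsolutions k) w ∧ integralSum (fun _ => ρ) u ≤ N * ∫ x, w x ∂ρ := by
  obtain ⟨w, huw, hw⟩ := exists_maximal_subsolution_ge
    (average_mem_subsolutions hsymm (u := fun i => u i) fun x => by
      rw [← separableSum_apply]; exact hu x)
  refine ⟨w, hw, ?_⟩
  have huρ : Integrable (fun y => ∑ j, u j y) ρ :=
    integrable_finsetSum _ fun j _ => (u j).integrable ρ
  have h := integral_mono (huρ.const_mul _) (integrable_of_maximal_subsolution ρ hk hw) huw
  rwa [integral_const_mul, integral_finsetSum _ fun j _ => (u j).integrable ρ,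
    inv_mul_le_iff₀ (by exact_mod_cast Nat.pos_of_neZero N), ← integralSum_apply] at h

theorem exists_subsolution_integral_subseq_tendsto {ι : Type*} [Fintype ι] [Nonempty ι]
    [TopologicalSpace.SeparableSpace X] [OpensMeasurableSpace X] [IsFiniteMeasure ρ]
    {k : (ι → X) →ᵇ ℝ} (hk : UniformContinuous k) {v : ℕ → X → ℝ}
    (hv : ∀ n, Maximal (· ∈ subsolutions k) (v n)) :
    ∃ u ∈ subsolutions k, Integrable u ρ ∧ ∃ s : ℕ → ℕ, StrictMono s ∧
      Tendsto (fun n => ∫ x, v (s n) x ∂ρ) atTop (𝓝 (∫ x, u x ∂ρ)) := by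
  have hbound : ∀ n x, v n x ∈ Icc (-(2 * ‖k‖)) (2 * ‖k‖) := fun n x =>
    abs_le.1 (abs_le_of_maximal_subsolution (hv n) k.norm_coe_le_norm x)
  obtain ⟨u, hu, huk, s, hs, hsu⟩ := exists_subseq_tendsto_of_equicontinuous
    ((uniformEquicontinuous_maximal_subsolutions hk).equicontinuous.comp fun n => ⟨v n, hv n⟩)
    (fun _ => isCompact_Icc) hbound
  refine ⟨u, fun x => ?_, ?_, s, hs, ?_⟩
  · exact le_of_tendsto' (tendsto_finsetSum _ fun i _ => hsu (x i)) fun n => (hv (s n)).prop x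
  · exact Integrable.of_bound hu.measurable.aestronglyMeasurable (2 * ‖k‖)
      (Eventually.of_forall fun x => abs_le.2 (huk x))
  · exact tendsto_integral_of_dominated_convergence (fun _ => 2 * ‖k‖)
      (fun n => (integrable_of_maximal_subsolution ρ hk (hv (s n))).aestronglyMeasurable)
      (integrable_const _)
      (fun n => Eventually.of_forall fun x => abs_le.2 (hbound (s n) x)) (Eventually.of_forall hsu)

end SymmetricDuality

theorem exists_mem_couplings_subsolution_integral_le {X : Type*} [MetricSpace X]
    [LocallyCompactSpace X] [SecondCountableTopology X] [MeasurableSpace X] [BorelSpace X]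
    (ρ : Measure X) [IsProbabilityMeasure ρ] {N : ℕ} [NeZero N] {k : (Fin N → X) →ᵇ ℝ}
    (hk : UniformContinuous k) (hsymm : ∀ (σ : Equiv.Perm (Fin N)) x, k (x ∘ σ) = k x) :
    ∃ P ∈ couplings (fun _ : Fin N => ρ), ∃ u ∈ subsolutions k, Integrable u ρ ∧
      ∫ x, k x ∂P ≤ N * ∫ x, u x ∂ρ := by
  obtain ⟨P, hP, hlub⟩ := exists_mem_couplings_isLUB (fun _ : Fin N => ρ) k
  obtain ⟨a, -, -, ha, hmem⟩ := hlub.exists_seq_monotone_tendsto hlub.nonempty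
  choose w hw hwa using hmem
  choose v hv hwv using fun n => exists_maximal_subsolution_integral_ge ρ hk hsymm (hw n)
  obtain ⟨u, hu, hui, s, hs, hsu⟩ := exists_subsolution_integral_subseq_tendsto ρ hk hv
  refine ⟨P, hP, u, hu, hui, ?_⟩
  exact le_of_tendsto_of_tendsto' (ha.comp hs.tendsto_atTop) (hsu.const_mul (N : ℝ)) fun n =>
    (hwa (s n)).symm.trans_le (hwv (s n))

/-! ### Pair interactions -/

section PairSum

variable {X : Type*} [PseudoMetricSpace X] {N : ℕ}

/-- The pair interaction energy `∑_{i < j} ψ(d(x_i, x_j))`, with real or extended values. -/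
def pairSum {M : Type*} [AddCommMonoid M] (ψ : ℝ → M) (x : Fin N → X) : M :=
  ∑ i, ∑ j ∈ Finset.Ioi i, ψ (dist (x i) (x j))

theorem pairSum_mono {ψ ψ' : ℝ → ℝ≥0∞} (h : ψ ≤ ψ') (x : Fin N → X) :
    pairSum ψ x ≤ pairSum ψ' x :=
  Finset.sum_le_sum fun _ _ => Finset.sum_le_sum fun _ _ => h _

theorem pairSum_congr {M : Type*} [AddCommMonoid M] {ψ ψ' : ℝ → M} {x : Fin N → X}
    (h : ∀ i j, i ≠ j → ψ (dist (x i) (x j)) = ψ' (dist (x i) (x j))) :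
    pairSum ψ x = pairSum ψ' x :=
  Finset.sum_congr rfl fun i _ => Finset.sum_congr rfl fun j hj => h i j (Finset.mem_Ioi.1 hj).ne

theorem pairSum_nonneg {ψ : ℝ → ℝ} (hψ : 0 ≤ ψ) (x : Fin N → X) : 0 ≤ pairSum ψ x :=
  Finset.sum_nonneg fun _ _ => Finset.sum_nonneg fun _ _ => hψ _

theorem pairSum_ofReal {ψ : ℝ → ℝ} (hψ : 0 ≤ ψ) (x : Fin N → X) :
    pairSum (fun t => ENNReal.ofReal (ψ t)) x = ENNReal.ofReal (pairSum ψ x) := by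
  rw [pairSum, pairSum,
    ENNReal.ofReal_sum_of_nonneg fun i _ => Finset.sum_nonneg fun j _ => hψ _]
  exact Finset.sum_congr rfl fun i _ => (ENNReal.ofReal_sum_of_nonneg fun j _ => hψ _).symm

theorem two_mul_pairSum (ψ : ℝ → ℝ) (x : Fin N → X) :
    2 * pairSum ψ x = ∑ i, ∑ j ∈ {i}ᶜ, ψ (dist (x j) (x i)) := by
  rw [← Finset.sum_sum_Ioi_add_eq_sum_sum_off_diag, pairSum, Finset.mul_sum]
  refine Finset.sum_congr rfl fun i _ => ?_
  rw [Finset.mul_sum]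
  exact Finset.sum_congr rfl fun j _ => by rw [dist_comm (x j), two_mul]

theorem pairSum_comp_perm (ψ : ℝ → ℝ) (σ : Equiv.Perm (Fin N)) (x : Fin N → X) :
    pairSum ψ (x ∘ σ) = pairSum ψ x := by
  refine mul_left_cancel₀ two_ne_zero ?_
  rw [two_mul_pairSum, two_mul_pairSum,
    ← Equiv.sum_comp σ fun i => ∑ j ∈ {i}ᶜ, ψ (dist (x j) (x i))]
  exact Finset.sum_congr rfl fun i _ => Finset.sum_equiv σ (by simp) fun _ _ => rfl

theorem pairSum_le {ψ : ℝ → ℝ} {a : ℝ} {x : Fin N → X}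
    (h : ∀ i j, i ≠ j → ψ (dist (x i) (x j)) ≤ a) : pairSum ψ x ≤ N * (N - 1) / 2 * a := by
  have hrow : ∀ i : Fin N, ∑ j ∈ {i}ᶜ, ψ (dist (x j) (x i)) ≤ (N - 1) * a := fun i => by
    refine (Finset.sum_le_card_nsmul _ _ a fun j hj => h j i (by simpa using hj)).trans_eq ?_
    rw [Finset.card_compl, Finset.card_singleton, Fintype.card_fin, nsmul_eq_mul,
      Nat.cast_pred i.pos]
  have hsum := Finset.sum_le_card_nsmul Finset.univ _ _ fun i _ => hrow i
  rw [← two_mul_pairSum, Finset.card_univ, Fintype.card_fin, nsmul_eq_mul] at hsum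
  linarith

theorem le_pairSum {ψ : ℝ → ℝ} (hψ : 0 ≤ ψ) (x : Fin N → X) {i j : Fin N} (hij : i ≠ j) :
    ψ (dist (x i) (x j)) ≤ pairSum ψ x := by
  wlog h : i < j generalizing i j
  · rw [dist_comm]
    exact this hij.symm (hij.lt_or_gt.resolve_left h)
  · exact (Finset.single_le_sum (f := fun j => ψ (dist (x i) (x j))) (fun _ _ => hψ _)
      (Finset.mem_Ioi.2 h)).trans (Finset.single_le_sum
        (f := fun i => ∑ j ∈ Finset.Ioi i, ψ (dist (x i) (x j)))
        (fun _ _ => Finset.sum_nonneg fun _ _ => hψ _) (Finset.mem_univ i))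

theorem uniformContinuous_finsetSum {ι Y : Type*} [UniformSpace Y] (s : Finset ι)
    {f : ι → Y → ℝ} (h : ∀ i ∈ s, UniformContinuous (f i)) :
    UniformContinuous fun y => ∑ i ∈ s, f i y := by
  classical
  induction s using Finset.induction_on with
  | empty => simpa only [Finset.sum_empty] using uniformContinuous_const
  | insert a s ha ih =>
    simp_rw [Finset.sum_insert ha]
    rw [Finset.forall_mem_insert] at h
    exact h.1.add (ih h.2)

theorem uniformContinuous_pairSum {ψ : ℝ → ℝ} (hψ : UniformContinuous ψ) :
    UniformContinuous (pairSum ψ : (Fin N → X) → ℝ) :=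
  uniformContinuous_finsetSum _ fun i _ => uniformContinuous_finsetSum _ fun j _ =>
    hψ.comp ((Pi.uniformContinuous_proj _ i).dist (Pi.uniformContinuous_proj _ j))

end PairSum

namespace IsRepulsive

variable {φ : ℝ → ℝ} {α β : ℝ}

theorem pos (hφ : IsRepulsive φ) {t : ℝ} (ht : 0 < t) : 0 < φ t :=
  have hlt : t < t + 1 := lt_add_one t
  (hφ.nonneg _ (ht.trans hlt)).trans_lt (hφ.strictAntiOn ht (ht.trans hlt) hlt)

theorem le_of_le (hφ : IsRepulsive φ) {s t : ℝ} (hs : 0 < s) (hst : s ≤ t) : φ t ≤ φ s :=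
  hφ.strictAntiOn.antitoneOn hs (hs.trans_le hst) hst

theorem apply_le_mul_apply (hφ : IsRepulsive φ) {N : ℕ} (hN : 1 < N) (hβ : 0 < β) :
    φ β ≤ (N : ℝ) ^ 2 * ((N : ℝ) - 1) / 2 * φ β := by
  have h : (2 : ℝ) ≤ N := by exact_mod_cast hN
  exact le_mul_of_one_le_left (hφ.nonneg β hβ) (by nlinarith)

theorem exists_eq (hφ : IsRepulsive φ) (hβ : 0 < β) {y : ℝ} (hy : φ β ≤ y) :
    ∃ t ∈ Ioi (0 : ℝ), φ t = y := by
  obtain ⟨t, hyt, ht0, htβ⟩ := ((hφ.tendsto_zero.eventually_ge_atTop y).and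
    (Ioc_mem_nhdsGT hβ)).exists
  obtain ⟨s, hs, rfl⟩ := intermediate_value_Icc' htβ
    (hφ.continuousOn.mono fun s hs => ht0.trans_le hs.1) ⟨hy, hyt⟩
  exact ⟨s, ht0.trans_le hs.1, rfl⟩

theorem inverse_pos (hφ : IsRepulsive φ) (hβ : 0 < β) {y : ℝ} (hy : φ β ≤ y) : 0 < inverse φ y :=
  Function.invFunOn_mem (hφ.exists_eq hβ hy)

theorem apply_inverse (hφ : IsRepulsive φ) (hβ : 0 < β) {y : ℝ} (hy : φ β ≤ y) :
    φ (inverse φ y) = y :=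
  Function.invFunOn_eq (hφ.exists_eq hβ hy)

theorem apply_max_pos (hφ : IsRepulsive φ) (hα : 0 < α) (t : ℝ) : 0 < φ (max t α) :=
  hφ.pos (lt_max_of_lt_right hα)

theorem truncate_eq (hφ : IsRepulsive φ) (hα : 0 < α) :
    truncate φ α = fun t => ENNReal.ofReal (φ (max t α)) := by
  funext t
  unfold truncate extend
  split_ifs with ht
  · rcases le_total t α with h | h
    · rw [max_eq_right h, min_eq_right (ENNReal.ofReal_le_ofReal (hφ.le_of_le ht h))]
    · rw [max_eq_left h, min_eq_left (ENNReal.ofReal_le_ofReal (hφ.le_of_le hα h))]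
  · rw [max_eq_right ((not_lt.1 ht).trans hα.le), min_eq_right le_top]

theorem truncate_eq_extend (hφ : IsRepulsive φ) (hα : 0 < α) {t : ℝ} (ht : α ≤ t) :
    truncate φ α t = extend φ t := by
  rw [hφ.truncate_eq hα]
  simp only [extend, if_pos (hα.trans_le ht), max_eq_left ht]

theorem uniformContinuous_apply_max (hφ : IsRepulsive φ) (hα : 0 < α) :
    UniformContinuous fun t => φ (max t α) := by
  have hanti : Antitone fun t => φ (max t α) := fun s t hst =>
    hφ.le_of_le (lt_max_of_lt_right hα) (max_le_max_right α hst)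
  have hlim := tendsto_atTop_ciInf hanti
    ⟨0, forall_mem_range.2 fun t => (hφ.apply_max_pos hα t).le⟩
  have habs : UniformContinuous fun t => φ (max |t| α) :=
    Continuous.uniformContinuous_of_tendsto_cocompact
      (hφ.continuousOn.comp_continuous (by fun_prop) fun _ => lt_max_of_lt_right hα)
      (hlim.comp (tendsto_norm_cocompact_atTop (E := ℝ)))
  have hmax : UniformContinuous fun t : ℝ => max t α :=
    (LipschitzWith.id.max_const α).uniformContinuous
  have heq : (fun t => φ (max t α)) = (fun t => φ (max |t| α)) ∘ fun t => max t α := by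
    funext t
    rw [Function.comp_apply, abs_of_pos (lt_max_of_lt_right hα), max_eq_left (le_max_right t α)]
  exact heq ▸ habs.comp hmax

end IsRepulsive

/-! ### Separation of contact tuples -/

theorem natCast_mul_lt_one_of_lt_threshold {N : ℕ} (hN : 1 < N) {μ : ℝ≥0∞} (hμ : μ < threshold N) :
    (((N - 1) * (N * N - N) : ℕ) : ℝ≥0∞) * μ < 1 := by
  have hcast : (((N - 1) * (N * N - N) : ℕ) : ℝ) = N * ((N : ℝ) - 1) ^ 2 := by
    rw [Nat.cast_mul, Nat.cast_pred (by lia), Nat.cast_sub (Nat.le_mul_self N)]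
    push_cast
    ring
  have hpos : 0 < N * ((N : ℝ) - 1) ^ 2 := by
    have : (1 : ℝ) < N := by exact_mod_cast hN
    have : 0 < (N : ℝ) - 1 := by linarith
    positivity
  refine ENNReal.mul_lt_of_lt_div' ?_
  rwa [threshold, ENNReal.ofReal_div_of_pos hpos, ENNReal.ofReal_one, ← hcast,
    ENNReal.ofReal_natCast] at hμ

theorem exists_pairwise_of_forall_exists {α : Type*} {r : α → α → Prop} [Std.Symm r]
    {s : Set α} {n : ℕ} (hs : ∀ m ≤ n, ∀ T : Fin m → α, ∃ y ∈ s, ∀ i, r (T i) y) {a : α}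
    (ha : a ∈ s) :
    ∃ T : Fin (n + 1) → α, T 0 = a ∧ (∀ i, T i ∈ s) ∧ Pairwise fun i j => r (T i) (T j) := by
  induction n with
  | zero =>
    exact ⟨fun _ => a, rfl, fun _ => ha,
      fun i j h => (h (Subsingleton.elim (α := Fin 1) i j)).elim⟩
  | succ n ih =>
    obtain ⟨T, hT0, hTs, hT⟩ := ih fun m hm => hs m (hm.trans n.le_succ)
    obtain ⟨y, hy, hTy⟩ := hs (n + 1) le_rfl T
    refine ⟨Fin.snoc T y, ?_, ?_, ?_⟩
    · rw [← Fin.castSucc_zero, Fin.snoc_castSucc, hT0]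
    · exact Fin.forall_fin_succ'.2 ⟨fun i => by rw [Fin.snoc_castSucc]; exact hTs i, by simpa⟩
    · intro i j
      induction i using Fin.lastCases <;> induction j using Fin.lastCases <;> intro hij
      · exact (hij rfl).elim
      · rw [Fin.snoc_last, Fin.snoc_castSucc]
        exact Std.Symm.symm _ _ (hTy _)
      · rw [Fin.snoc_last, Fin.snoc_castSucc]
        exact hTy _
      · rw [Fin.snoc_castSucc, Fin.snoc_castSucc]
        exact hT (by simpa using hij)

/-- The points at which the subsolution `u` of the cost `k` is sharp: an optimal plan is
concentrated on them. -/
def contactSet {ι X : Type*} [Fintype ι] (k : (ι → X) → ℝ) (u : X → ℝ) : Set (ι → X) :=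
  {x | ∑ i, u (x i) = k x}

theorem sum_le_sum_cyclic {X : Type*} {N : ℕ} [NeZero N] {k : (Fin N → X) → ℝ} {u : X → ℝ}
    (hu : u ∈ subsolutions k) {T : Fin N → Fin N → X} (hT : ∀ n, T n ∈ contactSet k u) :
    ∑ n, k (T n) ≤ ∑ m, k fun i => T (i + m) i :=
  calc ∑ n, k (T n) = ∑ n, ∑ i, u (T n i) := Finset.sum_congr rfl fun n _ => (hT n).symm
    _ = ∑ i, ∑ n, u (T n i) := Finset.sum_comm
    _ = ∑ i, ∑ m, u (T (i + m) i) := Finset.sum_congr rfl fun i _ =>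
        (Equiv.sum_comp (Equiv.addLeft i) fun n => u (T n i)).symm
    _ = ∑ m, ∑ i, u (T (i + m) i) := Finset.sum_comm
    _ ≤ ∑ m, k fun i => T (i + m) i := Finset.sum_le_sum fun _ _ => hu _

/-- Coordinates of `x` and `y` with different indices are at distance at least `β`; coordinates
with the same index may coincide. -/
def CrossSeparated {ι X : Type*} [PseudoMetricSpace X] (β : ℝ) (x y : ι → X) : Prop :=
  ∀ i j, i ≠ j → β ≤ dist (x i) (y j)

instance {ι X : Type*} [PseudoMetricSpace X] {β : ℝ} :
    Std.Symm (CrossSeparated β : (ι → X) → (ι → X) → Prop) where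
  symm _ _ h i j hij := by
    rw [dist_comm]
    exact h j i hij.symm

section Separation

variable {X : Type*} [PseudoMetricSpace X] [MeasurableSpace X] {ρ : Measure X} {β : ℝ}

theorem measure_coord_mem_ball_le [OpensMeasurableSpace X] {ι : Type*} {P : Measure (ι → X)}
    (hP : P ∈ couplings fun _ => ρ) (i : ι) (z : X) :
    P {y | y i ∈ Metric.ball z β} ≤ ⨆ x, ρ (Metric.ball x β) := by
  refine le_of_eq_of_le ?_ (le_iSup (fun x => ρ (Metric.ball x β)) z)
  have hmarg : P.map (fun x => x i) = ρ := hP.2 i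
  rw [← hmarg, Measure.map_apply (measurable_pi_apply i) measurableSet_ball]
  rfl

variable [OpensMeasurableSpace X] {N : ℕ} {P : Measure (Fin N → X)}

theorem exists_forall_crossSeparated (hN : 1 < N) (hP : P ∈ couplings fun _ => ρ)
    (hβ : ⨆ x, ρ (Metric.ball x β) < threshold N) {G : Set (Fin N → X)} (hG : ∀ᵐ x ∂P, x ∈ G)
    {m : ℕ} (hm : m < N) (T : Fin m → Fin N → X) : ∃ y ∈ G, ∀ n, CrossSeparated β (T n) y := by
  have := hP.1
  by_contra! h
  let bad (n : Fin m) (p : Fin N × Fin N) : Set (Fin N → X) :=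
    {y | y p.2 ∈ Metric.ball (T n p.1) β}
  have hcover : ∀ᵐ y ∂P, y ∈ ⋃ n, ⋃ p ∈ (Finset.univ : Finset (Fin N)).offDiag, bad n p := by
    filter_upwards [hG] with y hy
    obtain ⟨n, hn⟩ := h y hy
    simp only [CrossSeparated, not_forall, not_le] at hn
    obtain ⟨i, j, hij, hlt⟩ := hn
    simp only [mem_iUnion]
    exact ⟨n, (i, j), by simpa using hij, Metric.mem_ball'.2 hlt⟩
  refine (natCast_mul_lt_one_of_lt_threshold hN hβ).not_ge ?_
  calc (1 : ℝ≥0∞) = P univ := measure_univ.symm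
    _ ≤ P (⋃ n, ⋃ p ∈ (Finset.univ : Finset (Fin N)).offDiag, bad n p) :=
      measure_mono_ae (hcover.mono fun _ hy _ => hy)
    _ ≤ ∑ n : Fin m, ∑ p ∈ (Finset.univ : Finset (Fin N)).offDiag, P (bad n p) :=
      (measure_iUnion_fintype_le _ _).trans
        (Finset.sum_le_sum fun _ _ => measure_biUnion_finset_le _ _)
    _ ≤ ∑ _n : Fin m, ∑ _p ∈ (Finset.univ : Finset (Fin N)).offDiag, ⨆ x, ρ (Metric.ball x β) :=
      Finset.sum_le_sum fun _ _ => Finset.sum_le_sum fun _ _ => measure_coord_mem_ball_le hP _ _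
    _ = ((m * (N * N - N) : ℕ) : ℝ≥0∞) * ⨆ x, ρ (Metric.ball x β) := by
      simp only [Finset.sum_const, Finset.offDiag_card, Finset.card_univ, Fintype.card_fin,
        nsmul_eq_mul, Nat.cast_mul, mul_assoc]
    _ ≤ _ := by gcongr; lia

theorem exists_pairwise_crossSeparated [NeZero N] (hN : 1 < N) (hP : P ∈ couplings fun _ => ρ)
    (hβ : ⨆ x, ρ (Metric.ball x β) < threshold N) {G : Set (Fin N → X)} (hG : ∀ᵐ x ∂P, x ∈ G)
    {x : Fin N → X} (hx : x ∈ G) :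
    ∃ T : Fin N → Fin N → X, T 0 = x ∧ (∀ n, T n ∈ G) ∧
      Pairwise fun m n => CrossSeparated β (T m) (T n) := by
  obtain ⟨n, rfl⟩ := Nat.exists_eq_succ_of_ne_zero (NeZero.ne N)
  exact exists_pairwise_of_forall_exists
    (fun m hm => exists_forall_crossSeparated hN hP hβ hG (Nat.lt_succ_of_le hm)) hx

theorem le_dist_of_mem_contactSet {φ : ℝ → ℝ} {α : ℝ} (hN : 1 < N) (hφ : IsRepulsive φ)
    (hα : 0 < α) (hβ : 0 < β) (hαβ : (N : ℝ) ^ 2 * ((N : ℝ) - 1) / 2 * φ β ≤ φ α)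
    (hP : P ∈ couplings fun _ => ρ) (hρ : ⨆ x, ρ (Metric.ball x β) < threshold N) {u : X → ℝ}
    (hu : u ∈ subsolutions (pairSum (N := N) fun t => φ (max t α)))
    (hcontact : ∀ᵐ x ∂P, x ∈ contactSet (pairSum fun t => φ (max t α)) u) {x : Fin N → X}
    (hx : x ∈ contactSet (pairSum fun t => φ (max t α)) u) {i j : Fin N} (hij : i ≠ j) :
    α ≤ dist (x i) (x j) := by
  have : NeZero N := ⟨by lia⟩
  by_contra! hlt
  obtain ⟨T, rfl, hTG, hT⟩ := exists_pairwise_crossSeparated hN hP hρ hcontact hx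
  set k : (Fin N → X) → ℝ := pairSum fun t => φ (max t α)
  have hφ0 : (0 : ℝ → ℝ) ≤ fun t => φ (max t α) := fun t => (hφ.apply_max_pos hα t).le
  have hcyclic : ∀ m : Fin N, k (fun i => T (i + m) i) ≤ N * (N - 1) / 2 * φ β := fun m =>
    pairSum_le fun i j hij => hφ.le_of_le hβ <| le_max_of_le_left <|
      hT (fun h => hij (add_right_cancel h)) i j hij
  have hnear : φ α ≤ k (T 0) := by
    simpa only [max_eq_right hlt.le] using le_pairSum hφ0 (T 0) hij
  have hpos : ∀ y, 0 < k y := fun y =>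
    (hφ.apply_max_pos hα _).trans_le (le_pairSum hφ0 y hij)
  have : Nontrivial (Fin N) := ⟨i, j, hij⟩
  obtain ⟨n, hn⟩ := exists_ne (0 : Fin N)
  refine lt_irrefl (φ α) ?_
  calc φ α ≤ k (T 0) := hnear
    _ < ∑ n, k (T n) := Finset.single_lt_sum hn (Finset.mem_univ _) (Finset.mem_univ _)
        (hpos _) fun _ _ _ => (hpos _).le
    _ ≤ ∑ m, k fun i => T (i + m) i := sum_le_sum_cyclic hu hTG
    _ ≤ ∑ _m : Fin N, N * (N - 1) / 2 * φ β := Finset.sum_le_sum fun m _ => hcyclic m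
    _ = (N : ℝ) ^ 2 * ((N : ℝ) - 1) / 2 * φ β := by
        rw [Finset.sum_const, Finset.card_univ, Fintype.card_fin, nsmul_eq_mul]
        ring
    _ ≤ φ α := hαβ

end Separation

/-! ### Removing the truncation -/

theorem ereal_coe_le_coe_ennreal_iff {a : ℝ} {b : ℝ≥0∞} :
    (a : EReal) ≤ (b : EReal) ↔ ENNReal.ofReal a ≤ b := by
  rw [← EReal.coe_ennreal_le_coe_ennreal_iff, EReal.coe_ennreal_ofReal,
    EReal.coe_strictMono.monotone.map_max, EReal.coe_zero, max_le_iff,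
    and_iff_left (EReal.coe_ennreal_nonneg b)]

theorem ofReal_integral_le_lintegral_ofReal {Y : Type*} [MeasurableSpace Y] {μ : Measure Y}
    {f : Y → ℝ} (hf : Integrable f μ) :
    ENNReal.ofReal (∫ y, f y ∂μ) ≤ ∫⁻ y, ENNReal.ofReal (f y) ∂μ := by
  rw [integral_eq_lintegral_pos_part_sub_lintegral_neg_part hf]
  exact (ENNReal.ofReal_le_ofReal (sub_le_self _ ENNReal.toReal_nonneg)).trans
    ENNReal.ofReal_toReal_le

section Marginals

variable {ι : Type*} {X : ι → Type*} [∀ i, MeasurableSpace (X i)] {μ : ∀ i, Measure (X i)}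
  {P : Measure (∀ i, X i)} {u : ∀ i, X i → ℝ}

theorem integrable_coord_of_mem_couplings (hP : P ∈ couplings μ) {i : ι}
    (hu : Integrable (u i) (μ i)) : Integrable (fun x => u i (x i)) P :=
  (hP.2 i ▸ hu).comp_measurable (measurable_pi_apply i)

theorem integral_coord_of_mem_couplings (hP : P ∈ couplings μ) {i : ι}
    (hu : AEStronglyMeasurable (u i) (μ i)) : ∫ x, u i (x i) ∂P = ∫ y, u i y ∂μ i := by
  rw [← hP.2 i] at hu ⊢
  exact (integral_map (measurable_pi_apply i).aemeasurable hu).symm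

variable [Fintype ι]

theorem integrable_sum_coord_of_mem_couplings (hP : P ∈ couplings μ)
    (hu : ∀ i, Integrable (u i) (μ i)) : Integrable (fun x => ∑ i, u i (x i)) P :=
  integrable_finsetSum _ fun i _ => integrable_coord_of_mem_couplings hP (hu i)

theorem integral_sum_coord_of_mem_couplings (hP : P ∈ couplings μ)
    (hu : ∀ i, Integrable (u i) (μ i)) :
    ∫ x, ∑ i, u i (x i) ∂P = ∑ i, ∫ y, u i y ∂μ i := by
  rw [integral_finsetSum _ fun i _ => integrable_coord_of_mem_couplings hP (hu i)]
  exact Finset.sum_congr rfl fun i _ =>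
    integral_coord_of_mem_couplings hP (hu i).aestronglyMeasurable

end Marginals

section DualProblem

variable {X : Type*} [MeasurableSpace X] {N : ℕ} {ρ : Measure X}

/-- The competitors of the dual problem for the extended-valued cost `k` on an arbitrary space, as
in `dualAdmissible`: integrable functions `u` with `∑ i, u (x i) ≤ k x` everywhere. -/
def dualCompetitors (k : (Fin N → X) → ℝ≥0∞) (ρ : Measure X) : Set (X → ℝ) :=
  {u | Integrable u ρ ∧
    ∀ x : Fin N → X, ((∑ i, u (x i) : ℝ) : EReal) ≤ ((k x : ℝ≥0∞) : EReal)}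

theorem dualCompetitors_mono {k k' : (Fin N → X) → ℝ≥0∞} (h : k ≤ k') :
    dualCompetitors k ρ ⊆ dualCompetitors k' ρ := fun _ hu =>
  ⟨hu.1, fun x => (hu.2 x).trans (EReal.coe_ennreal_le_coe_ennreal_iff.2 (h x))⟩

/-- The maximizers of the dual problem for the cost `k` on an arbitrary space, as in
`IsKantorovichPotential`. -/
def dualMaximizers (k : (Fin N → X) → ℝ≥0∞) (ρ : Measure X) : Set (X → ℝ) :=
  {u | u ∈ dualCompetitors k ρ ∧
    IsMaxOn (fun v => (N : ℝ) * ∫ y, v y ∂ρ) (dualCompetitors k ρ) u}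

theorem integral_sum_eq_natCast_mul {P : Measure (Fin N → X)} (hP : P ∈ couplings fun _ => ρ)
    {u : X → ℝ} (hu : Integrable u ρ) : ∫ x, ∑ i, u (x i) ∂P = N * ∫ y, u y ∂ρ := by
  rw [integral_sum_coord_of_mem_couplings (u := fun _ => u) hP fun _ => hu, Finset.sum_const,
    Finset.card_univ, Fintype.card_fin, nsmul_eq_mul]

theorem natCast_mul_integral_le_lintegral {k : (Fin N → X) → ℝ≥0∞} {u : X → ℝ}
    (hu : u ∈ dualCompetitors k ρ) {P : Measure (Fin N → X)} (hP : P ∈ couplings fun _ => ρ) :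
    ((N * ∫ y, u y ∂ρ : ℝ) : EReal) ≤ ((∫⁻ x, k x ∂P : ℝ≥0∞) : EReal) := by
  rw [ereal_coe_le_coe_ennreal_iff, ← integral_sum_eq_natCast_mul hP hu.1]
  exact (ofReal_integral_le_lintegral_ofReal
    (integrable_sum_coord_of_mem_couplings (u := fun _ => u) hP fun _ => hu.1)).trans
    (lintegral_mono fun x => ereal_coe_le_coe_ennreal_iff.1 (hu.2 x))

theorem lintegral_eq_iInf_of_eq_natCast_mul_integral {k : (Fin N → X) → ℝ≥0∞} {u : X → ℝ}
    (hu : u ∈ dualCompetitors k ρ) {P : Measure (Fin N → X)} (hP : P ∈ couplings fun _ => ρ)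
    (h : ((∫⁻ x, k x ∂P : ℝ≥0∞) : EReal) = ((N * ∫ y, u y ∂ρ : ℝ) : EReal)) :
    ∫⁻ x, k x ∂P = ⨅ Q ∈ couplings fun _ : Fin N => ρ, ∫⁻ x, k x ∂Q := by
  refine le_antisymm (le_iInf₂ fun Q hQ => ?_) (iInf₂_le P hP)
  rw [← EReal.coe_ennreal_le_coe_ennreal_iff, h]
  exact natCast_mul_integral_le_lintegral hu hQ

theorem isGreatest_natCast_mul_integral {k : (Fin N → X) → ℝ≥0∞} {u : X → ℝ}
    (hu : u ∈ dualCompetitors k ρ) {P : Measure (Fin N → X)} (hP : P ∈ couplings fun _ => ρ)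
    (h : ((∫⁻ x, k x ∂P : ℝ≥0∞) : EReal) = ((N * ∫ y, u y ∂ρ : ℝ) : EReal)) :
    IsGreatest ((fun v : X → ℝ => ((N * ∫ y, v y ∂ρ : ℝ) : EReal)) '' dualCompetitors k ρ)
      ((∫⁻ x, k x ∂P : ℝ≥0∞) : EReal) :=
  ⟨⟨u, hu, h.symm⟩, forall_mem_image.2 fun _ hv => natCast_mul_integral_le_lintegral hv hP⟩

theorem integral_eq_and_ae_mem_contactSet {k : (Fin N → X) → ℝ} {u : X → ℝ}
    (hu : u ∈ subsolutions k) (hui : Integrable u ρ) {P : Measure (Fin N → X)}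
    (hP : P ∈ couplings fun _ => ρ) (hk : Integrable k P) (h : ∫ x, k x ∂P ≤ N * ∫ y, u y ∂ρ) :
    ∫ x, k x ∂P = N * ∫ y, u y ∂ρ ∧ ∀ᵐ x ∂P, x ∈ contactSet k u := by
  have hsum := integrable_sum_coord_of_mem_couplings (u := fun _ => u) hP fun _ => hui
  rw [← integral_sum_eq_natCast_mul hP hui] at h ⊢
  have heq := le_antisymm h (integral_mono hsum hk hu)
  exact ⟨heq, (integral_eq_iff_of_ae_le hsum hk (Eventually.of_forall hu)).1 heq.symm⟩

end DualProblem

theorem dualCompetitors_truncate_subset {X : Type*} [PseudoMetricSpace X] [MeasurableSpace X]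
    {ρ : Measure X} {N : ℕ} {φ : ℝ → ℝ} {α : ℝ} :
    dualCompetitors (N := N) (pairSum (truncate φ α)) ρ ⊆
      dualCompetitors (N := N) (pairSum (extend φ)) ρ :=
  dualCompetitors_mono (pairSum_mono fun _ => min_le_left _ _)

section RepulsiveCost

variable {X : Type*} [MetricSpace X] [LocallyCompactSpace X] [SecondCountableTopology X]
  [MeasurableSpace X] [BorelSpace X] {ρ : Measure X} [IsProbabilityMeasure ρ] {N : ℕ} {φ : ℝ → ℝ}
  {α β : ℝ}

theorem exists_mem_couplings_subsolution_contact [NeZero N] (hφ : IsRepulsive φ) (hα : 0 < α) :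
    ∃ P ∈ couplings (fun _ : Fin N => ρ),
      ∃ u ∈ subsolutions (pairSum (N := N) fun t => φ (max t α)), Integrable u ρ ∧
        Integrable (pairSum fun t => φ (max t α)) P ∧
        ∫ x, pairSum (fun t => φ (max t α)) x ∂P = N * ∫ y, u y ∂ρ ∧
        ∀ᵐ x ∂P, x ∈ contactSet (pairSum fun t => φ (max t α)) u := by
  have hbound : ∀ x : Fin N → X,
      ‖pairSum (fun t => φ (max t α)) x‖ ≤ N * (N - 1) / 2 * φ α := fun x => by
    rw [Real.norm_of_nonneg (pairSum_nonneg (fun t => (hφ.apply_max_pos hα t).le) x)]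
    exact pairSum_le fun i j _ => hφ.le_of_le hα (le_max_right _ _)
  have huc : UniformContinuous (pairSum (fun t => φ (max t α)) : (Fin N → X) → ℝ) :=
    uniformContinuous_pairSum (hφ.uniformContinuous_apply_max hα)
  obtain ⟨P, hP, u, hu, hui, hle⟩ := exists_mem_couplings_subsolution_integral_le ρ
    (k := .ofNormedAddCommGroup _ huc.continuous _ hbound) huc
    (pairSum_comp_perm fun t => φ (max t α))
  have := hP.1
  have hk := Integrable.of_bound huc.continuous.aestronglyMeasurable _
    (Eventually.of_forall hbound) (μ := P)
  exact ⟨P, hP, u, hu, hui, hk, integral_eq_and_ae_mem_contactSet hu hui hP hk hle⟩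

theorem exists_mem_couplings_dualCompetitor_eq (hN : 1 < N) (hφ : IsRepulsive φ) (hα : 0 < α)
    (hβ : 0 < β) (hαβ : (N : ℝ) ^ 2 * ((N : ℝ) - 1) / 2 * φ β ≤ φ α)
    (hρ : ⨆ x, ρ (Metric.ball x β) < threshold N) :
    ∃ P ∈ couplings (fun _ : Fin N => ρ),
      ∃ u ∈ dualCompetitors (N := N) (pairSum (truncate φ α)) ρ,
        ((∫⁻ x, pairSum (extend φ) x ∂P : ℝ≥0∞) : EReal) = ((N * ∫ y, u y ∂ρ : ℝ) : EReal) := by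
  have : NeZero N := ⟨by lia⟩
  have hφ0 : (0 : ℝ → ℝ) ≤ fun t => φ (max t α) := fun t => (hφ.apply_max_pos hα t).le
  have htrunc : ∀ x : Fin N → X,
      pairSum (truncate φ α) x = ENNReal.ofReal (pairSum (fun t => φ (max t α)) x) := fun x => by
    rw [hφ.truncate_eq hα, pairSum_ofReal hφ0]
  obtain ⟨P, hP, u, hu, hui, hk, hval, hcontact⟩ :=
    exists_mem_couplings_subsolution_contact (ρ := ρ) (N := N) hφ hα
  have hagree : ∀ᵐ x ∂P, pairSum (extend φ) x = pairSum (truncate φ α) x := by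
    filter_upwards [hcontact] with x hx
    exact (pairSum_congr fun i j hij => hφ.truncate_eq_extend hα
      (le_dist_of_mem_contactSet hN hφ hα hβ hαβ hP hρ hu hcontact hx hij)).symm
  refine ⟨P, hP, u, ⟨hui, fun x => ?_⟩, ?_⟩
  · rw [ereal_coe_le_coe_ennreal_iff, htrunc]
    exact ENNReal.ofReal_le_ofReal (hu x)
  · simp_rw [lintegral_congr_ae hagree, htrunc]
    rw [← ofReal_integral_eq_lintegral_ofReal hk (Eventually.of_forall (pairSum_nonneg hφ0)),
      EReal.coe_ennreal_ofReal, max_eq_left (integral_nonneg (pairSum_nonneg hφ0)), hval]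

theorem exists_mem_couplings_dualCompetitor_eq_of_le_inverse (hN : 1 < N) (hφ : IsRepulsive φ)
    (hα : 0 < α) (hβ : 0 < β) (hαβ : α ≤ inverse φ ((N : ℝ) ^ 2 * ((N : ℝ) - 1) / 2 * φ β))
    (hρ : ⨆ x, ρ (Metric.ball x β) < threshold N) :
    ∃ P ∈ couplings (fun _ : Fin N => ρ),
      ∃ u ∈ dualCompetitors (N := N) (pairSum (truncate φ α)) ρ,
        ((∫⁻ x, pairSum (extend φ) x ∂P : ℝ≥0∞) : EReal) = ((N * ∫ y, u y ∂ρ : ℝ) : EReal) := by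
  refine exists_mem_couplings_dualCompetitor_eq hN hφ hα hβ ?_ hρ
  rw [← hφ.apply_inverse hβ (hφ.apply_le_mul_apply hN hβ)]
  exact hφ.le_of_le hα hαβ

theorem dualMaximizers_truncate_subset (hN : 1 < N) (hφ : IsRepulsive φ) (hα : 0 < α)
    (hβ : 0 < β) (hαβ : α ≤ inverse φ ((N : ℝ) ^ 2 * ((N : ℝ) - 1) / 2 * φ β))
    (hρ : ⨆ x, ρ (Metric.ball x β) < threshold N) :
    dualMaximizers (N := N) (pairSum (truncate φ α)) ρ ⊆
      dualMaximizers (N := N) (pairSum (extend φ)) ρ := fun w hw => by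
  obtain ⟨P, hP, u, hu, hPu⟩ :=
    exists_mem_couplings_dualCompetitor_eq_of_le_inverse hN hφ hα hβ hαβ hρ
  refine ⟨dualCompetitors_truncate_subset hw.1, fun v hv => ?_⟩
  have hle := natCast_mul_integral_le_lintegral hv hP
  rw [hPu, EReal.coe_le_coe_iff] at hle
  exact hle.trans (hw.2 hu)

theorem mainTheorem2_general (hN : 1 < N) (hφ : IsRepulsive φ)
    (hA : ∃ β > 0, ⨆ x, ρ (Metric.ball x β) < threshold N) :
    (∃ P ∈ couplings fun _ : Fin N => ρ, ∫⁻ x, pairSum (extend φ) x ∂P =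
      ⨅ Q ∈ couplings fun _ : Fin N => ρ, ∫⁻ x, pairSum (extend φ) x ∂Q) ∧
    IsGreatest ((fun u : X → ℝ => ((N * ∫ y, u y ∂ρ : ℝ) : EReal)) ''
        dualCompetitors (N := N) (pairSum (extend φ)) ρ)
      ((⨅ Q ∈ couplings fun _ : Fin N => ρ, ∫⁻ x, pairSum (extend φ) x ∂Q : ℝ≥0∞) : EReal) ∧
    ∀ β : ℝ, 0 < β → ⨆ x, ρ (Metric.ball x β) < threshold N →
      ∀ α : ℝ, 0 < α → α ≤ inverse φ ((N : ℝ) ^ 2 * ((N : ℝ) - 1) / 2 * φ β) →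
        ∀ u ∈ dualMaximizers (N := N) (pairSum (truncate φ α)) ρ,
          u ∈ dualMaximizers (N := N) (pairSum (extend φ)) ρ := by
  obtain ⟨β, hβ, hρ⟩ := hA
  obtain ⟨P, hP, u, hu, hPu⟩ := exists_mem_couplings_dualCompetitor_eq_of_le_inverse hN hφ
    (hφ.inverse_pos hβ (hφ.apply_le_mul_apply hN hβ)) hβ le_rfl hρ
  have hu' := dualCompetitors_truncate_subset hu
  have hmin := lintegral_eq_iInf_of_eq_natCast_mul_integral hu' hP hPu
  refine ⟨⟨P, hP, hmin⟩, ?_, fun β hβ hρ α hα hαβ _ hw =>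
    dualMaximizers_truncate_subset hN hφ hα hβ hαβ hρ hw⟩
  rw [← hmin]
  exact isGreatest_natCast_mul_integral hu' hP hPu

end RepulsiveCost

theorem pairCost_eq_pairSum {d N : ℕ} (ψ : ℝ → ℝ≥0∞) :
    (pairCost ψ : (Fin N → Space d) → ℝ≥0∞) = pairSum ψ := by
  funext x
  simp only [pairCost, pairSum, dist_eq_norm]

theorem SmallConcentration.exists_concentration_lt {d N : ℕ} {ρ : Measure (Space d)}
    (hA : SmallConcentration N ρ) : ∃ β > 0, concentration ρ β < threshold N := by
  obtain ⟨l, hl, hlt⟩ := hA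
  obtain ⟨β, hρ, hβ⟩ := ((hl.eventually_lt_const hlt).and self_mem_nhdsWithin).exists
  exact ⟨β, hβ, hρ⟩

end RepulsiveOT

end

theorem mainTheorem2 (d N : ℕ) (hN : 1 < N) (φ : ℝ → ℝ) (hφ : IsRepulsive φ)
    (ρ : Measure (Space d)) [IsProbabilityMeasure ρ] (hA : SmallConcentration N ρ) :
    -- `C(ρ)` is a minimum
    (∃ P ∈ plans N ρ, ∫⁻ x, cost φ x ∂P = transportCost (N := N) (cost φ) ρ) ∧
    -- `C(ρ)` is the maximum of the dual problem
    IsGreatest ((fun u => ((dualValue N ρ u : ℝ) : EReal)) '' dualAdmissible (N := N) (cost φ) ρ)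
      ((transportCost (N := N) (cost φ) ρ : ℝ≥0∞) : EReal) ∧
    -- potentials for the truncated cost are potentials for the cost
    ∀ β : ℝ, 0 < β → concentration ρ β < threshold N →
      ∀ α : ℝ, 0 < α → α ≤ inverse φ ((N : ℝ) ^ 2 * ((N : ℝ) - 1) / 2 * φ β) →
        ∀ u : Space d → ℝ, IsKantorovichPotential (N := N) (truncatedCost φ α) ρ u →
          IsKantorovichPotential (N := N) (cost φ) ρ u := by
  simp only [cost, truncatedCost, pairCost_eq_pairSum]
  exact mainTheorem2_general hN hφ hA.exists_concentration_lt
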